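/- Let $\mathcal E$ be a finite non-empty set of basic events, $\Omega=\{0,1\}^{\mathcal E}$ the set of atoms, $\Sigma=\mathcal P(\Omega)$ the algebra of events, and for a probability $\Pr$ on $\Omega$ give $\Omega^\infty$ the product probability, also written $\Pr$. Past-time temporal logic $\mathrm{TL}$ over $\mathcal E$ has the Boolean connectives (an event of $\Sigma$ is written as a Boolean combination of basic events), "previously" $\ominus$ and $\mathsf{Since}$, evaluated in the states of finite non-empty words over $\Omega$: $\ominus\varphi$ holds in a state that is not the initial one and whose predecessor satisfies $\varphi$, and $\varphi\,\mathsf{Since}\,\psi$ holds in $s$ iff $\psi$ holds in some $t\le s$ and $\varphi$ holds in all $u$ with $t<u\le s$; "once" is $\Diamond\varphi=(\mathit{true}\,\mathsf{Since}\,\varphi)$. A conditional $c=(\varphi|\psi)$ with $\varphi,\psi\in\mathrm{TL}$ takes on a word the value $1$, $0$ or $\bot$ according to whether $\varphi\wedge\psi$, $\neg\varphi\wedge\psi$ or $\neg\psi$ holds in its last state. It gives the stochastic process $c_1,c_2,\dots$ on $\Omega^\infty$, where $c_n(w)$ is the value of $c$ on the prefix of $w$ of length $n$. Its asymptotic probability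 is $\Pr(c)=\lim_n \Pr(c_n=1)/\Pr(c_n\ne\bot)$, provided that the denominators are non-zero for all large $n$ and the limit exists. Two conditionals $c,d$ are independent if for all $t\geq 1$ and $x,y\in\{0,1,\bot\}^t$ the events $\{(c_1,\dots,c_t)=x\}$ and $\{(d_1,\dots,d_t)=y\}$ are independent. Flat conditional expressions are built from simple conditionals $(a|b)$, $a,b\in\Sigma$, by $\wedge,\vee,\sim$. In the product space (PS) conditional event algebra, $(a|b)$ denotes $\bigcup_{j\ge0}(\Omega\setminus b)^j\times(a\cap b)\times\Omega\times\Omega\times\cdots\subseteq\Omega^\infty$, the connectives denote intersection, union and complement, and $\Pr_o(e)$ is the product probability of the set denoted by $e$. The first embedding sends $e$ to $F(e)=(e^F|\mathit{true})$, where $e^F\in\mathrm{TL}$ arises from $e$ by replacing each $(a|b)$ by $\Diamond(a\wedge b\wedge\neg\ominus\Diamond b)$. The sparse reverse interpretation sends $e$ to $R(e)=(e^R|\bigvee_i(b_i\vee\neg\Diamond b_i))$, where $(a_i|b_i)$ are the simple conditionals occurring in $e$ and $e^R$ arises from $e$ by replacing each $(a|b)$ by $\neg b\,\mathsf{Since}\,(a\wedge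 b)$. Then: 1. For every probability $\Pr$ on $\Omega$ and every flat expression $e$, the asymptotic probabilities of $F(e)$ and $R(e)$ exist and $\Pr(F(e))=\Pr(R(e))=\Pr_o(e)$. 2. Let $\Pr$ be a probability on $\Omega$, let $a\in\Sigma$ with $0<\Pr(a)<1$, and let $e_1=e_2=(\varnothing|a)$. The processes of $F(e_1)$ and $F(e_2)$ are constantly $0$, hence independent, while $R(e_1)$ and $R(e_2)$ are not independent. Consequently no set of equalities between (possibly partial) real functions of finitely many asymptotic probabilities of interpreted flat expressions holds exactly if $e_1,e_2$ have independent interpretations, simultaneously for the interpretation $F$ and for the interpretation $R$. In particular there are a probability on $\Omega$ and expressions $e_1,e_2$ such that $F(e_1),F(e_2)$ are independent and $R(e_1),R(e_2)$ are not. 3. Independence in the PS conditional event algebra cannot be characterized by equalities of asymptotic probabilities: there is no assignment of a set $S(e_1,e_2)$ of such equalities to the pairs of flat expressions (not depending on the probability on $\Omega$) such that, for both $I=F$ and $I=R$, for every probability on $\Omega$ and all $e_1,e_2$, the conditionals $I(e_1),I(e_2)$ are independent if and only if all equalities in $S(e_1,e_2)$ hold between the asymptotic probabilities $\Pr(I(e))$.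 (An equality whose sides are both undefined counts as holding.) -/

import Mathlib

open MeasureTheory Filter Topology

noncomputable section

namespace CondEvent

/-- The set `Ω` of atoms of the Boolean algebra freely generated by the basic events `E`:
an atom is a truth assignment to the basic events. It is also a state of a temporal model. -/
abbrev Atom (E : Type*) := E → Bool

/-- The Boolean algebra `Σ` of events, i.e. the power set of `Ω`. -/
abbrev Event (E : Type*) := Set (Atom E)

/-- The three truth values `0`, `1` and `⊥` (undefined). -/
inductive Three
  | zero
  | one
  | undef

/-! ### Temporal logic of linear discrete past time -/

/-- Formulas of past-time temporal logic over the basic events `E`. -/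
inductive TL (E : Type*)
  | tru : TL E
  | basic : E → TL E
  | neg : TL E → TL E
  | disj : TL E → TL E → TL E
  | prev : TL E → TL E
  | since : TL E → TL E → TL E

namespace TL

variable {E : Type*}

/-- Conjunction. -/
def conj (φ ψ : TL E) : TL E := neg (disj (neg φ) (neg ψ))

/-- `once φ`: the formula `true Since φ`. -/
def once (φ : TL E) : TL E := since tru φ

/-- Satisfaction in the state `s` of the finite model `M = s₀, …, sₙ`. -/
def Sat {n : ℕ} (M : Fin (n + 1) → Atom E) : TL E → Fin (n + 1) → Prop
  | tru, _ => True
  | basic a, s => M s a = true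
  | neg φ, s => ¬ Sat M φ s
  | disj φ ψ, s => Sat M φ s ∨ Sat M ψ s
  | prev φ, s => ∃ t : Fin (n + 1), (t : ℕ) + 1 = s ∧ Sat M φ t
  | since φ ψ, s => ∃ t : Fin (n + 1), t ≤ s ∧ Sat M ψ t ∧
      ∀ u : Fin (n + 1), t < u → u ≤ s → Sat M φ u

/-- Finite disjunctions. -/
def disjList (l : List (TL E)) : TL E := l.foldr disj (neg tru)

/-- Finite conjunctions. -/
def conjList (l : List (TL E)) : TL E := l.foldr conj tru

/-- The conjunction of literals describing an atom. -/
def ofAtom [Fintype E] (ω : Atom E) : TL E :=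
  conjList ((Finset.univ : Finset E).toList.map
    fun a => if ω a = true then basic a else neg (basic a))

/-- An event written as a propositional formula (in full disjunctive normal form). -/
def ofEvent [Fintype E] (x : Event E) : TL E :=
  disjList ((Set.toFinite x).toFinset.toList.map ofAtom)

theorem sat_disjList {n : ℕ} (M : Fin (n + 1) → Atom E) (s : Fin (n + 1)) (l : List (TL E)) :
    Sat M (disjList l) s ↔ ∃ φ ∈ l, Sat M φ s := by
  induction l with
  | nil => simp [disjList, Sat]
  | cons φ l ih =>
    have h : disjList (φ :: l) = disj φ (disjList l) := rfl
    simp [h, Sat, ih]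

theorem sat_conjList {n : ℕ} (M : Fin (n + 1) → Atom E) (s : Fin (n + 1)) (l : List (TL E)) :
    Sat M (conjList l) s ↔ ∀ φ ∈ l, Sat M φ s := by
  induction l with
  | nil => simp [conjList, Sat]
  | cons φ l ih =>
    have h : conjList (φ :: l) = conj φ (conjList l) := rfl
    simp [h, conj, Sat, ih]

theorem sat_ofAtom [Fintype E] {n : ℕ} (M : Fin (n + 1) → Atom E) (s : Fin (n + 1))
    (ω : Atom E) : Sat M (ofAtom ω) s ↔ M s = ω := by
  simp only [ofAtom, sat_conjList, List.mem_map, Finset.mem_toList, Finset.mem_univ, true_and,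
    forall_exists_index, forall_apply_eq_imp_iff]
  constructor
  · intro h
    funext a
    have := h a
    cases hω : ω a <;> simp_all [Sat]
  · rintro rfl a
    split <;> simp_all [Sat]

/-- The propositional formula of an event holds exactly in the states that lie in the event. -/
theorem sat_ofEvent [Fintype E] {n : ℕ} (M : Fin (n + 1) → Atom E) (s : Fin (n + 1))
    (x : Event E) : Sat M (ofEvent x) s ↔ M s ∈ x := by
  simp [ofEvent, sat_disjList, sat_ofAtom]

end TL

/-! ### Conditional objects and conditional events -/

/-- A formula `(φ|ψ)` of the three-valued logic `(TL|TL)`. -/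
structure CondFormula (E : Type*) where
  concl : TL E
  given : TL E

/-- Nonempty finite words over `Ω`; the word `⟨n, M⟩` has length `n + 1`. -/
abbrev Word (E : Type*) := Σ n : ℕ, (Fin (n + 1) → Atom E)

open Classical in
/-- The conditional object of `(φ|ψ)`: its truth value in the last state of a word. -/
def CondFormula.object {E : Type*} (c : CondFormula E) (w : Word E) : Three :=
  if c.given.Sat w.2 (Fin.last w.1) then
    if c.concl.Sat w.2 (Fin.last w.1) then Three.one else Three.zero
  else Three.undef

/-- The conditional event of a conditional object as a stochastic process on `Ω^∞`;
`process c n` is the value on the prefix of length `n + 1`, so the times `1, 2, 3, …` are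
numbered `0, 1, 2, …`. -/
def process {E : Type*} (c : Word E → Three) (n : ℕ) (w : ℕ → Atom E) : Three :=
  c ⟨n, fun i => w i⟩

/-- The product probability on `Ω^∞`. -/
def prodProb {E : Type*} [Fintype E] (μ : Measure (Atom E)) [IsProbabilityMeasure μ] :
    Measure (ℕ → Atom E) :=
  Measure.infinitePi fun _ : ℕ => μ

section Prob

variable {E : Type*} [Fintype E] (μ : Measure (Atom E)) [IsProbabilityMeasure μ]

/-- `r` is the asymptotic probability of `c`: for all sufficiently large `n` the probability
that `c` is defined at time `n` is nonzero, and the quotients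
`Pr(cₙ = 1) / Pr(cₙ = 0 or 1)` tend to `r`. -/
def HasAsympProb (c : Word E → Three) (r : ℝ) : Prop :=
  (∀ᶠ n in atTop, (prodProb μ).real {w | process c n w ≠ Three.undef} ≠ 0) ∧
  Tendsto (fun n => (prodProb μ).real {w | process c n w = Three.one} /
    (prodProb μ).real {w | process c n w ≠ Three.undef}) atTop (𝓝 r)

open Classical in
/-- The asymptotic probability of `c`, with value `none` when it is undefined. -/
def asympProb (c : Word E → Three) : Option ℝ :=
  if h : ∃ r, HasAsympProb μ c r then some h.choose else none

/-- Independence of the conditional events of `c` and `d` as stochastic processes: the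
histories up to any time are independent. -/
def Indep (c d : Word E → Three) : Prop :=
  ∀ (t : ℕ) (x y : Fin t → Three),
    prodProb μ {w | (∀ i : Fin t, process c i w = x i) ∧ ∀ i : Fin t, process d i w = y i} =
      prodProb μ {w | ∀ i : Fin t, process c i w = x i} *
        prodProb μ {w | ∀ i : Fin t, process d i w = y i}

end Prob

/-! ### Flat conditional expressions and the product space algebra -/

/-- Flat conditional expressions. -/
inductive FlatExpr (E : Type*)
  | simple : Event E → Event E → FlatExpr E
  | conj : FlatExpr E → FlatExpr E → FlatExpr E
  | disj : FlatExpr E → FlatExpr E → FlatExpr E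
  | neg : FlatExpr E → FlatExpr E

namespace FlatExpr

variable {E : Type*}

/-- The element of the product space algebra denoted by an expression. For `(a|b)` it is the
union over `j` of the cylinders `(Ω \ b)^j × (b ∩ a) × Ω × Ω × ⋯`. -/
def ps : FlatExpr E → Set (ℕ → Atom E)
  | simple a b => ⋃ j : ℕ, {w | (∀ i < j, w i ∈ bᶜ) ∧ w j ∈ b ∩ a}
  | conj e e' => ps e ∩ ps e'
  | disj e e' => ps e ∪ ps e'
  | neg e => (ps e)ᶜ

/-- The product space probability of an expression. -/
def psProb [Fintype E] (μ : Measure (Atom E)) [IsProbabilityMeasure μ] (e : FlatExpr E) : ℝ :=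
  (prodProb μ).real e.ps

variable [Fintype E]

/-- The temporal formula of the first embedding; `(a|b)` becomes
`once (a ∧ b ∧ ¬ previously (once b))`. -/
def firstTL : FlatExpr E → TL E
  | simple a b => TL.once (TL.conj (TL.conj (TL.ofEvent a) (TL.ofEvent b))
      (TL.neg (TL.prev (TL.once (TL.ofEvent b)))))
  | conj e e' => TL.conj (firstTL e) (firstTL e')
  | disj e e' => TL.disj (firstTL e) (firstTL e')
  | neg e => TL.neg (firstTL e)

/-- The first embedding of the product space algebra into conditional objects. -/
def first (e : FlatExpr E) : Word E → Three :=
  CondFormula.object ⟨firstTL e, TL.tru⟩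

/-- The temporal formula of the reverse embedding; `(a|b)` becomes `¬b Since (a ∧ b)`. -/
def revTL : FlatExpr E → TL E
  | simple a b => TL.since (TL.neg (TL.ofEvent b)) (TL.conj (TL.ofEvent a) (TL.ofEvent b))
  | conj e e' => TL.conj (revTL e) (revTL e')
  | disj e e' => TL.disj (revTL e) (revTL e')
  | neg e => TL.neg (revTL e)

/-- The disjunction of `b ∨ ¬ once b` over all simple conditionals `(a|b)` occurring in the
expression. -/
def sparseGiven : FlatExpr E → TL E
  | simple _ b => TL.disj (TL.ofEvent b) (TL.neg (TL.once (TL.ofEvent b)))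
  | conj e e' => TL.disj (sparseGiven e) (sparseGiven e')
  | disj e e' => TL.disj (sparseGiven e) (sparseGiven e')
  | neg e => sparseGiven e

/-- The sparse reverse interpretation of the product space algebra in conditional objects. -/
def sparse (e : FlatExpr E) : Word E → Three :=
  CondFormula.object ⟨revTL e, sparseGiven e⟩

end FlatExpr

/-! ### Equalities of asymptotic probabilities -/

/-- One side of an equality of probabilities: a (possibly partial) real function, for instance
a polynomial or a quotient, applied to the probabilities of finitely many flat expressions. -/
structure ProbTerm (E : Type*) where
  arity : ℕ
  arg : Fin arity → FlatExpr E
  fn : (Fin arity → ℝ) → Option ℝ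

open Classical in
/-- The value of a term under a (partial) assignment of probabilities to the expressions;
it is undefined if one of the probabilities in it is. -/
def ProbTerm.value {E : Type*} (P : FlatExpr E → Option ℝ) (τ : ProbTerm E) : Option ℝ :=
  if h : ∀ i, (P (τ.arg i)).isSome = true then τ.fn fun i => (P (τ.arg i)).get (h i) else none

/-- All equalities of the set `S` hold under the assignment `P`; an equality with both sides
undefined holds. -/
def EqualitiesHold {E : Type*} (P : FlatExpr E → Option ℝ) (S : Set (ProbTerm E × ProbTerm E)) :
    Prop :=
  ∀ q ∈ S, q.1.value P = q.2.value P

/-- Under the interpretation `I` of expressions as conditional objects, the equalities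
`S e₁ e₂` (which do not depend on the probability space) hold between asymptotic probabilities
exactly when `e₁` and `e₂` are interpreted by independent processes. -/
def CharacterizesIndep {E : Type*} [Fintype E] (I : FlatExpr E → Word E → Three)
    (S : FlatExpr E → FlatExpr E → Set (ProbTerm E × ProbTerm E)) : Prop :=
  ∀ (μ : Measure (Atom E)) [IsProbabilityMeasure μ] (e₁ e₂ : FlatExpr E),
    Indep μ (I e₁) (I e₂) ↔ EqualitiesHold (fun e => asympProb μ (I e)) (S e₁ e₂)

end CondEvent

end

open CondEvent

/-!
At time `n` the formula `F(e)` sees exactly the first `n` cylinders of the sets denoted by the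
simple conditionals in `e`. These truncations converge pointwise to the product space event `A`
denoted by `e`, so their probabilities converge.

For `R(e)` reverse the order of the letters up to the present, which preserves the product
probability. It turns `¬b Since (a ∧ b)` into the truncation of `(a|b)`, so the conclusion of `R(e)`
tends to `A` again. The condition tends to the union `D`, over all `b`, of the events that the first
letter lies in `b` or that `b` never occurs. If some `b` is null, then `D` is almost sure. Otherwise
`D` says almost surely that the first letter lies in the union of the sets `b`; outside of that
union `A` is invariant under the shift, so `A` is independent of `D`. In both cases
`Pr(A ∩ D) / Pr(D) = Pr(A)`.

Thus all asymptotic probabilities agree under `F` and `R`, and an equality between them cannot tell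
the two interpretations apart. Independence does: the process of `(∅|a)` is constant under `F`,
while under `R` it starts with `0, ⊥` with probability `Pr(a) (1 - Pr(a))`, and a process that is
independent of itself has only histories of probability `0` or `1`.
-/

namespace CondEvent

/-! ### Independent sequences of letters -/

section Sequences

open ProbabilityTheory

variable {α : Type*}

/-- The cylinder `(Ω \ b)ʲ × (b ∩ a) × Ω × Ω × ⋯`. -/
def hitCylinder (a b : Set α) (j : ℕ) : Set (ℕ → α) :=
  {w | (∀ i < j, w i ∈ bᶜ) ∧ w j ∈ b ∩ a}

/-- The sequences in which `b` occurs at the beginning or not at all: what becomes of the sparse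
condition `b ∨ ¬ once b` when time is reversed and the present moves to infinity. -/
def headOrNever (b : Set α) : Set (ℕ → α) :=
  {w | w 0 ∈ b} ∪ {w | ∀ i, w i ∉ b}

/-- The approximation of `headOrNever b` that looks at the letters with index at most `n` only. -/
def headOrNeverUpTo (n : ℕ) (b : Set α) : Set (ℕ → α) :=
  {w | w 0 ∈ b} ∪ {w | ∀ i ≤ n, w i ∉ b}

/-- The sequence `w` with its letters of index at most `n` put in reverse order. -/
def reversePrefix (n : ℕ) (w : ℕ → α) (i : ℕ) : α := w (if i ≤ n then n - i else i)

theorem reversePrefix_of_le {n i : ℕ} (w : ℕ → α) (hi : i ≤ n) :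
    reversePrefix n w i = w (n - i) := by
  rw [reversePrefix, if_pos hi]

theorem reversePrefix_sub {n i : ℕ} (w : ℕ → α) (hi : i ≤ n) :
    reversePrefix n w (n - i) = w i := by
  rw [reversePrefix_of_le w (Nat.sub_le n i), Nat.sub_sub_self hi]

theorem eventually_mem_accumulate_iff {s : ℕ → Set α} (x : α) :
    ∀ᶠ n in atTop, x ∈ Set.accumulate s n ↔ x ∈ ⋃ n, s n := by
  by_cases hx : ∃ j, x ∈ s j
  · obtain ⟨j, hj⟩ := hx
    filter_upwards [eventually_ge_atTop j] with n hn
    exact iff_of_true (Set.mem_accumulate.2 ⟨j, hn, hj⟩) (Set.mem_iUnion.2 ⟨j, hj⟩)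
  · push Not at hx
    exact Eventually.of_forall fun n =>
      iff_of_false (by simp [Set.mem_accumulate, hx]) (by simp [hx])

theorem headOrNever_eq (b : Set α) :
    headOrNever b = {w | w 0 ∈ b} ∪ (⋃ i, {w | w i ∈ b})ᶜ := by
  ext w; simp [headOrNever]

theorem headOrNeverUpTo_eq (n : ℕ) (b : Set α) :
    headOrNeverUpTo n b = {w | w 0 ∈ b} ∪ (Set.accumulate (fun i => {w | w i ∈ b}) n)ᶜ := by
  ext w; simp [headOrNeverUpTo, Set.mem_accumulate]

theorem reversePrefix_mem_headOrNeverUpTo_iff (n : ℕ) (w : ℕ → α) (b : Set α) :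
    reversePrefix n w ∈ headOrNeverUpTo n b ↔ w n ∈ b ∨ ∀ i ≤ n, w i ∉ b := by
  refine or_congr (by simp [reversePrefix]) ⟨fun h i hi => ?_, fun h i hi => ?_⟩
  · rw [← reversePrefix_sub w hi]
    exact h (n - i) (Nat.sub_le n i)
  · rw [reversePrefix_of_le w hi]
    exact h (n - i) (Nat.sub_le n i)

theorem eventually_mem_headOrNeverUpTo_iff (b : Set α) (w : ℕ → α) :
    ∀ᶠ n in atTop, w ∈ headOrNeverUpTo n b ↔ w ∈ headOrNever b := by
  simp only [headOrNever_eq, headOrNeverUpTo_eq]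
  filter_upwards [eventually_mem_accumulate_iff (s := fun i => {w | w i ∈ b}) w] with n hn
  exact or_congr Iff.rfl (not_congr hn)

theorem mem_iUnion_hitCylinder_iff_tail {a b : Set α} {w : ℕ → α} (h0 : w 0 ∉ b) :
    w ∈ ⋃ j, hitCylinder a b j ↔ (fun i => w (i + 1)) ∈ ⋃ j, hitCylinder a b j := by
  simp only [Set.mem_iUnion]
  rw [← Nat.or_exists_add_one, or_iff_right fun h => h0 h.2.1]
  refine exists_congr fun j => and_congr_left fun _ => ?_
  rw [Nat.forall_lt_succ_left]
  exact and_iff_right h0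

variable [MeasurableSpace α]

theorem measurableSet_letter_mem {b : Set α} (hb : MeasurableSet b) (i : ℕ) :
    MeasurableSet {w : ℕ → α | w i ∈ b} :=
  measurable_pi_apply i hb

theorem measurableSet_hitCylinder {a b : Set α} (ha : MeasurableSet a) (hb : MeasurableSet b)
    (j : ℕ) : MeasurableSet (hitCylinder a b j) := by
  have h : hitCylinder a b j = (⋂ i < j, {w | w i ∈ bᶜ}) ∩ {w | w j ∈ b ∩ a} := by
    ext w; simp [hitCylinder]
  rw [h]
  exact (MeasurableSet.biInter (Set.to_countable _) fun i _ =>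
    measurableSet_letter_mem hb.compl i).inter (measurableSet_letter_mem (hb.inter ha) j)

theorem measurableSet_headOrNeverUpTo {b : Set α} (hb : MeasurableSet b) (n : ℕ) :
    MeasurableSet (headOrNeverUpTo n b) := by
  rw [headOrNeverUpTo_eq]
  exact (measurableSet_letter_mem hb 0).union
    (.compl (.biUnion (Set.to_countable _) fun i _ => measurableSet_letter_mem hb i))

theorem indepFun_subfamily_of_notMem_range {Ω ι κ : Type*} [MeasurableSpace Ω] {P : Measure Ω}
    {X : ι → Ω → α} (hX : iIndepFun X P) (hmeas : ∀ i, Measurable (X i)) {i : ι} {f : κ → ι}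
    (hi : i ∉ Set.range f) : IndepFun (X i) (fun ω k => X (f k) ω) P := by
  have hindep := indep_iSup_of_disjoint (fun j => (hmeas j).comap_le) hX.iIndep
    (Set.disjoint_singleton_left.2 hi)
  rw [IndepFun_iff_Indep]
  refine indep_of_indep_of_le_left (indep_of_indep_of_le_right hindep ?_) ?_
  · rw [MeasurableSpace.pi, MeasurableSpace.comap_iSup]
    refine iSup_le fun k => ?_
    rw [MeasurableSpace.comap_comp]
    exact le_iSup₂_of_le (f k) (Set.mem_range_self k) le_rfl
  · exact le_iSup₂_of_le i (Set.mem_singleton i) le_rfl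

variable (μ : Measure α) [IsProbabilityMeasure μ]

theorem measurePreserving_reversePrefix (n : ℕ) :
    MeasurePreserving (reversePrefix n) (Measure.infinitePi fun _ : ℕ => μ)
      (Measure.infinitePi fun _ : ℕ => μ) := by
  refine ⟨by unfold reversePrefix; fun_prop, ?_⟩
  have hinj : Function.Injective fun i : ℕ => if i ≤ n then n - i else i := by
    intro i j hij
    grind
  exact Measure.map_infinitePi_infinitePi_of_inj (P := fun _ : ℕ => μ) hinj

theorem measurePreserving_tail :
    MeasurePreserving (fun (w : ℕ → α) i => w (i + 1)) (Measure.infinitePi fun _ : ℕ => μ)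
      (Measure.infinitePi fun _ : ℕ => μ) :=
  ⟨by fun_prop,
    Measure.map_infinitePi_infinitePi_of_inj (P := fun _ : ℕ => μ) (add_left_injective 1)⟩

theorem indepFun_head_tail :
    IndepFun (fun w : ℕ → α => w 0) (fun w i => w (i + 1)) (Measure.infinitePi fun _ : ℕ => μ) :=
  indepFun_subfamily_of_notMem_range (f := Nat.succ) (X := fun i (w : ℕ → α) => w i)
    (iIndepFun_infinitePi (X := fun _ => id) fun _ => measurable_id) measurable_pi_apply
    (by simp)

theorem infinitePi_letter_mem {ι : Type*} (i : ι) {b : Set α} (hb : MeasurableSet b) :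
    Measure.infinitePi (fun _ : ι => μ) {w | w i ∈ b} = μ b :=
  (measurePreserving_eval_infinitePi (fun _ => μ) i).measure_preimage hb.nullMeasurableSet

theorem infinitePi_letters_mem {ι : Type*} {i j : ι} (hij : i ≠ j) {a b : Set α}
    (ha : MeasurableSet a) (hb : MeasurableSet b) :
    Measure.infinitePi (fun _ : ι => μ) {w | w i ∈ a ∧ w j ∈ b} = μ a * μ b := by
  rw [← Measure.prod_prod, ← Measure.infinitePi_map_eval_prod (P := fun _ => μ) hij,
    Measure.map_apply (by fun_prop) (ha.prod hb)]
  rfl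

theorem ae_infinitePi_forall_notMem {ι : Type*} [Countable ι] {b : Set α} (h0 : μ b = 0) :
    ∀ᵐ w ∂Measure.infinitePi fun _ : ι => μ, ∀ i, w i ∉ b :=
  ae_all_iff.2 fun i => (measurePreserving_eval_infinitePi (fun _ => μ) i).quasiMeasurePreserving.ae
    (measure_eq_zero_iff_ae_notMem.1 h0)

theorem ae_infinitePi_exists_mem {ι : Type*} [Infinite ι] {b : Set α} (hb : MeasurableSet b)
    (h0 : μ b ≠ 0) : ∀ᵐ w ∂Measure.infinitePi fun _ : ι => μ, ∃ i, w i ∈ b := by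
  have hlt : μ bᶜ < 1 := prob_le_one.lt_of_ne ((prob_compl_eq_one_iff hb).not.2 h0)
  have hle (n : ℕ) :
      Measure.infinitePi (fun _ : ι => μ) {w | ¬ ∃ i, w i ∈ b} ≤ μ bᶜ ^ n := by
    obtain ⟨s, rfl⟩ := Infinite.exists_subset_card_eq ι n
    rw [← Finset.prod_const, ← Measure.infinitePi_pi _ fun _ _ => hb.compl]
    exact measure_mono fun w hw i _ hi => hw ⟨i, hi⟩
  exact le_zero_iff.1 (ge_of_tendsto' (ENNReal.tendsto_pow_atTop_nhds_zero_of_lt_one hlt) hle)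

theorem headOrNever_ae_eq_univ {b : Set α} (h0 : μ b = 0) :
    headOrNever b =ᵐ[Measure.infinitePi fun _ : ℕ => μ] Set.univ :=
  eventuallyEq_univ.2 ((ae_infinitePi_forall_notMem μ h0).mono fun _ hw => Or.inr hw)

theorem headOrNever_ae_eq_head_mem {b : Set α} (hb : MeasurableSet b) (h0 : μ b ≠ 0) :
    headOrNever b =ᵐ[Measure.infinitePi fun _ : ℕ => μ] {w | w 0 ∈ b} :=
  eventuallyEq_set.2 ((ae_infinitePi_exists_mem μ hb h0).mono fun _ ⟨i, hi⟩ =>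
    or_iff_left fun hw => hw i hi)

theorem infinitePi_headOrNever_ne_zero {b : Set α} (hb : MeasurableSet b) :
    Measure.infinitePi (fun _ : ℕ => μ) (headOrNever b) ≠ 0 := by
  by_cases h0 : μ b = 0
  · rw [measure_congr (headOrNever_ae_eq_univ μ h0), measure_univ]
    exact one_ne_zero
  · rwa [measure_congr (headOrNever_ae_eq_head_mem μ hb h0), infinitePi_letter_mem μ 0 hb]

/-- Away from `b` the event `A` amounts to itself one step later, and the tail is independent of
the head. -/
theorem infinitePi_inter_head_mem {A : Set (ℕ → α)} {b : Set α} (hA : MeasurableSet A)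
    (hb : MeasurableSet b) (htail : ∀ w, w 0 ∉ b → (w ∈ A ↔ (fun i => w (i + 1)) ∈ A)) :
    (Measure.infinitePi fun _ : ℕ => μ).real (A ∩ {w | w 0 ∈ b}) =
      (Measure.infinitePi fun _ : ℕ => μ).real A * μ.real b := by
  set P := Measure.infinitePi fun _ : ℕ => μ
  have hshift : A \ {w | w 0 ∈ b} = {w | w 0 ∈ bᶜ} ∩ {w | (fun i => w (i + 1)) ∈ A} := by
    ext w
    exact and_comm.trans (and_congr_right (htail w))
  have hdiff : P.real (A \ {w | w 0 ∈ b}) = (1 - μ.real b) * P.real A := by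
    have hindep := (indepFun_head_tail μ).measure_inter_preimage_eq_mul bᶜ A hb.compl hA
    rw [(measurePreserving_tail μ).measure_preimage hA.nullMeasurableSet] at hindep
    rw [hshift, ← probReal_compl_eq_one_sub hb]
    simp only [Measure.real, ← ENNReal.toReal_mul]
    rw [← infinitePi_letter_mem μ 0 hb.compl]
    exact congrArg ENNReal.toReal hindep
  have hadd := measureReal_inter_add_sdiff (μ := P) (s := A) (measurableSet_letter_mem hb 0)
  linarith

theorem infinitePi_inter_biUnion_headOrNever {A : Set (ℕ → α)} {B : Set (Set α)}
    (hA : MeasurableSet A) (hBc : B.Countable) (hB : ∀ b ∈ B, MeasurableSet b)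
    (htail : ∀ w, w 0 ∉ ⋃₀ B → (w ∈ A ↔ (fun i => w (i + 1)) ∈ A)) :
    (Measure.infinitePi fun _ : ℕ => μ).real (A ∩ ⋃ b ∈ B, headOrNever b) =
      (Measure.infinitePi fun _ : ℕ => μ).real A *
        (Measure.infinitePi fun _ : ℕ => μ).real (⋃ b ∈ B, headOrNever b) := by
  set P := Measure.infinitePi fun _ : ℕ => μ
  by_cases hnull : ∃ b ∈ B, μ b = 0
  · obtain ⟨b, hbB, hb0⟩ := hnull
    have huniv : (⋃ b ∈ B, headOrNever b) =ᵐ[P] Set.univ :=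
      eventuallyEq_univ.2 (mem_of_superset (eventuallyEq_univ.1 (headOrNever_ae_eq_univ μ hb0))
        (Set.subset_biUnion_of_mem hbB))
    rw [measureReal_congr huniv, measureReal_congr ((ae_eq_refl A).inter huniv), Set.inter_univ,
      probReal_univ, mul_one]
  · push Not at hnull
    have hhead : (⋃ b ∈ B, headOrNever b) =ᵐ[P] {w | w 0 ∈ ⋃₀ B} := by
      have hunion : {w : ℕ → α | w 0 ∈ ⋃₀ B} = ⋃ b ∈ B, {w | w 0 ∈ b} := by
        ext w
        simp only [Set.mem_sUnion, Set.mem_ofPred_eq, Set.mem_iUnion, exists_prop]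
      rw [hunion]
      exact Filter.EventuallyEq.countable_bUnion hBc fun b hb =>
        headOrNever_ae_eq_head_mem μ (hB b hb) (hnull b hb)
    have hU : MeasurableSet (⋃₀ B) := .sUnion hBc hB
    rw [measureReal_congr hhead, measureReal_congr ((ae_eq_refl A).inter hhead),
      infinitePi_inter_head_mem μ hA hU htail, measureReal_def P {w | w 0 ∈ ⋃₀ B},
      infinitePi_letter_mem μ 0 hU, measureReal_def μ]

end Sequences

/-! ### Temporal formulas along an infinite sequence -/

variable {E : Type*}

/-- Satisfaction of a past-time formula at time `n` of an infinite sequence of states. It only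
depends on the prefix of length `n + 1`, see `TL.sat_prefix_iff`. -/
def TL.Holds (w : ℕ → Atom E) : TL E → ℕ → Prop
  | tru, _ => True
  | basic a, n => w n a = true
  | neg φ, n => ¬ Holds w φ n
  | disj φ ψ, n => Holds w φ n ∨ Holds w ψ n
  | prev φ, n => ∃ t, t + 1 = n ∧ Holds w φ t
  | since φ ψ, n => ∃ t ≤ n, Holds w ψ t ∧ ∀ u, t < u → u ≤ n → Holds w φ u

namespace TL

theorem sat_prefix_iff (w : ℕ → Atom E) (φ : TL E) {n : ℕ} (s : Fin (n + 1)) :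
    φ.Sat (fun i : Fin (n + 1) => w i) s ↔ φ.Holds w s := by
  induction φ generalizing s with
  | tru => rfl
  | basic a => rfl
  | neg φ ih => exact not_congr (ih s)
  | disj φ ψ ihφ ihψ => exact or_congr (ihφ s) (ihψ s)
  | prev φ ih =>
    simp only [Sat, Holds, ih, Fin.exists_iff]
    grind
  | since φ ψ ihφ ihψ =>
    simp only [Sat, Holds, ihφ, ihψ, Fin.exists_iff, Fin.forall_iff, Fin.le_def, Fin.lt_def]
    grind

theorem holds_conj (w : ℕ → Atom E) (φ ψ : TL E) (n : ℕ) :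
    (conj φ ψ).Holds w n ↔ φ.Holds w n ∧ ψ.Holds w n := by
  simp only [conj, Holds, not_or, not_not]

theorem holds_once (w : ℕ → Atom E) (φ : TL E) (n : ℕ) :
    (once φ).Holds w n ↔ ∃ t ≤ n, φ.Holds w t := by
  simp only [once, Holds, implies_true, and_true]

theorem holds_ofEvent [Fintype E] (w : ℕ → Atom E) (x : Event E) (n : ℕ) :
    (ofEvent x).Holds w n ↔ w n ∈ x := by
  rw [← Fin.val_last n, ← sat_prefix_iff, sat_ofEvent]

end TL

theorem measurableSet_event [Finite E] (b : Event E) : MeasurableSet b :=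
  (Set.toFinite b).measurableSet

open Classical in
/-- The three-valued indicator of the conditional event `(A|D)`. -/
noncomputable def condIndicator {X : Type*} (A D : Set X) (x : X) : Three :=
  if x ∈ D then if x ∈ A then Three.one else Three.zero else Three.undef

theorem condIndicator_congr {X Y : Type*} {A D : Set X} {B C : Set Y} {x : X} {y : Y}
    (hAB : x ∈ A ↔ y ∈ B) (hDC : x ∈ D ↔ y ∈ C) : condIndicator A D x = condIndicator B C y := by
  classical
  exact if_congr hDC (if_congr hAB rfl rfl) rfl

theorem condIndicator_eq_one_iff {X : Type*} {A D : Set X} {x : X} :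
    condIndicator A D x = Three.one ↔ x ∈ A ∩ D := by
  by_cases hA : x ∈ A <;> by_cases hD : x ∈ D <;> simp [condIndicator, hA, hD]

theorem condIndicator_eq_undef_iff {X : Type*} {A D : Set X} {x : X} :
    condIndicator A D x = Three.undef ↔ x ∉ D := by
  by_cases hA : x ∈ A <;> by_cases hD : x ∈ D <;> simp [condIndicator, hA, hD]

theorem process_object (c : CondFormula E) (n : ℕ) (w : ℕ → Atom E) :
    process c.object n w =
      condIndicator {w | c.concl.Holds w n} {w | c.given.Holds w n} w := by
  classical
  exact if_congr (TL.sat_prefix_iff w c.given (Fin.last n))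
    (if_congr (TL.sat_prefix_iff w c.concl (Fin.last n)) rfl rfl) rfl

/-! ### Flat expressions read forwards and backwards -/

namespace FlatExpr

/-- The events `b` of the simple conditionals `(a|b)` that occur in an expression. -/
def conditions : FlatExpr E → Set (Event E)
  | simple _ b => {b}
  | conj e e' => conditions e ∪ conditions e'
  | disj e e' => conditions e ∪ conditions e'
  | neg e => conditions e

/-- The approximation of `ps` that looks at the letters with index at most `n` only: each
`(a|b)` contributes its cylinders up to the `n`-th one. -/
def psUpTo (n : ℕ) : FlatExpr E → Set (ℕ → Atom E)
  | simple a b => Set.accumulate (hitCylinder a b) n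
  | conj e e' => psUpTo n e ∩ psUpTo n e'
  | disj e e' => psUpTo n e ∪ psUpTo n e'
  | neg e => (psUpTo n e)ᶜ

theorem conditions_nonempty (e : FlatExpr E) : e.conditions.Nonempty := by
  induction e with
  | simple _ b => exact Set.singleton_nonempty b
  | conj _ _ ih _ => exact ih.inl
  | disj _ _ ih _ => exact ih.inl
  | neg _ ih => exact ih

theorem eventually_mem_psUpTo_iff (e : FlatExpr E) (w : ℕ → Atom E) :
    ∀ᶠ n in atTop, w ∈ psUpTo n e ↔ w ∈ ps e := by
  induction e with
  | simple a b => exact eventually_mem_accumulate_iff w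
  | conj e e' ih ih' => filter_upwards [ih, ih'] with n h h' using and_congr h h'
  | disj e e' ih ih' => filter_upwards [ih, ih'] with n h h' using or_congr h h'
  | neg e ih => filter_upwards [ih] with n h using not_congr h

theorem mem_ps_iff_tail (e : FlatExpr E) {w : ℕ → Atom E} (h0 : w 0 ∉ ⋃₀ e.conditions) :
    w ∈ ps e ↔ (fun i => w (i + 1)) ∈ ps e := by
  induction e with
  | simple a b => exact mem_iUnion_hitCylinder_iff_tail (by simpa [conditions] using h0)
  | conj e e' ih ih' =>
    rw [conditions, Set.sUnion_union] at h0
    exact and_congr (ih fun h => h0 (.inl h)) (ih' fun h => h0 (.inr h))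
  | disj e e' ih ih' =>
    rw [conditions, Set.sUnion_union] at h0
    exact or_congr (ih fun h => h0 (.inl h)) (ih' fun h => h0 (.inr h))
  | neg e ih => exact not_congr (ih h0)

section Finite

variable [Finite E]

theorem eventually_mem_biUnion_headOrNeverUpTo_iff (e : FlatExpr E) (w : ℕ → Atom E) :
    ∀ᶠ n in atTop, w ∈ ⋃ b ∈ e.conditions, headOrNeverUpTo n b ↔
      w ∈ ⋃ b ∈ e.conditions, headOrNever b := by
  have h := (Set.toFinite e.conditions).eventually_all.2 fun b _ =>
    eventually_mem_headOrNeverUpTo_iff b w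
  filter_upwards [h] with n hn
  simp only [Set.mem_iUnion]
  exact exists₂_congr hn

theorem measurableSet_psUpTo (e : FlatExpr E) (n : ℕ) : MeasurableSet (psUpTo n e) := by
  induction e with
  | simple a b =>
    exact .biUnion (Set.to_countable _) fun j _ =>
      measurableSet_hitCylinder (measurableSet_event a) (measurableSet_event b) j
  | conj e e' ih ih' => exact ih.inter ih'
  | disj e e' ih ih' => exact ih.union ih'
  | neg e ih => exact ih.compl

theorem measurableSet_ps (e : FlatExpr E) : MeasurableSet (ps e) :=
  measurableSet_of_tendsto_indicator atTop e.measurableSet_psUpTo e.eventually_mem_psUpTo_iff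

end Finite

section Fintype

variable [Fintype E]

theorem holds_firstTL_iff (e : FlatExpr E) (n : ℕ) (w : ℕ → Atom E) :
    (firstTL e).Holds w n ↔ w ∈ psUpTo n e := by
  induction e with
  | simple a b =>
    simp only [firstTL, TL.holds_once, TL.holds_conj, TL.holds_ofEvent, TL.Holds, psUpTo,
      Set.mem_accumulate, hitCylinder, Set.mem_ofPred_eq, Set.mem_inter_iff, Set.mem_compl_iff]
    have hfirst (t : ℕ) : (¬∃ s, s + 1 = t ∧ ∃ u ≤ s, w u ∈ b) ↔ ∀ i < t, w i ∉ b :=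
      ⟨fun h i hi hib => h ⟨t - 1, by omega, i, by omega, hib⟩,
        fun h ⟨s, hs, u, hu, hub⟩ => h u (by omega) hub⟩
    simp only [hfirst]
    grind
  | conj e e' ih ih' => exact (TL.holds_conj w _ _ n).trans (and_congr ih ih')
  | disj e e' ih ih' => exact or_congr ih ih'
  | neg e ih => exact not_congr ih

theorem holds_revTL_iff (e : FlatExpr E) (n : ℕ) (w : ℕ → Atom E) :
    (revTL e).Holds w n ↔ reversePrefix n w ∈ psUpTo n e := by
  induction e with
  | simple a b =>
    simp only [revTL, TL.holds_conj, TL.holds_ofEvent, TL.Holds, psUpTo, Set.mem_accumulate,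
      hitCylinder, Set.mem_ofPred_eq, Set.mem_inter_iff, Set.mem_compl_iff]
    constructor
    · rintro ⟨t, ht, ⟨ha, hb⟩, hafter⟩
      refine ⟨n - t, Nat.sub_le n t, fun i hi => ?_, ?_⟩
      · rw [reversePrefix_of_le w (by omega)]
        exact hafter (n - i) (by omega) (Nat.sub_le n i)
      · rw [reversePrefix_sub w ht]
        exact ⟨hb, ha⟩
    · rintro ⟨j, hj, hbefore, hb, ha⟩
      rw [reversePrefix_of_le w hj] at ha hb
      refine ⟨n - j, Nat.sub_le n j, ⟨ha, hb⟩, fun u hu hun => ?_⟩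
      rw [← reversePrefix_sub w hun]
      exact hbefore (n - u) (by omega)
  | conj e e' ih ih' => exact (TL.holds_conj w _ _ n).trans (and_congr ih ih')
  | disj e e' ih ih' => exact or_congr ih ih'
  | neg e ih => exact not_congr ih

theorem holds_sparseGiven_iff (e : FlatExpr E) (n : ℕ) (w : ℕ → Atom E) :
    (sparseGiven e).Holds w n ↔
      reversePrefix n w ∈ ⋃ b ∈ e.conditions, headOrNeverUpTo n b := by
  induction e with
  | simple _ b =>
    simp only [sparseGiven, TL.Holds, TL.holds_once, TL.holds_ofEvent, conditions,
      Set.mem_singleton_iff, Set.iUnion_iUnion_eq_left, reversePrefix_mem_headOrNeverUpTo_iff,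
      not_exists, not_and]
  | conj e e' ih ih' =>
    rw [conditions, Set.biUnion_union]
    exact or_congr ih ih'
  | disj e e' ih ih' =>
    rw [conditions, Set.biUnion_union]
    exact or_congr ih ih'
  | neg _ ih => exact ih

theorem process_first (e : FlatExpr E) (n : ℕ) (w : ℕ → Atom E) :
    process e.first n w = condIndicator (psUpTo n e) Set.univ w :=
  (process_object _ n w).trans (condIndicator_congr (holds_firstTL_iff e n w) Iff.rfl)

theorem process_sparse (e : FlatExpr E) (n : ℕ) (w : ℕ → Atom E) :
    process e.sparse n w =
      condIndicator (psUpTo n e) (⋃ b ∈ e.conditions, headOrNeverUpTo n b) (reversePrefix n w) :=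
  (process_object _ n w).trans
    (condIndicator_congr (holds_revTL_iff e n w) (holds_sparseGiven_iff e n w))

end Fintype

end FlatExpr

/-! ### Asymptotic probabilities -/

section Asymptotic

variable [Fintype E] {μ : Measure (Atom E)} [IsProbabilityMeasure μ]

instance : IsProbabilityMeasure (prodProb μ) := by
  unfold prodProb
  infer_instance

theorem tendsto_measureReal_of_tendsto_indicator {X : Type*} [MeasurableSpace X] {P : Measure X}
    [IsFiniteMeasure P] {A : ℕ → Set X} {B : Set X} (hA : ∀ n, MeasurableSet (A n))
    (hlim : ∀ x, ∀ᶠ n in atTop, x ∈ A n ↔ x ∈ B) :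
    Tendsto (fun n => P.real (A n)) atTop (𝓝 (P.real B)) :=
  (ENNReal.tendsto_toReal (measure_ne_top P B)).comp
    (tendsto_measure_of_tendsto_indicator_of_isFiniteMeasure atTop P hA hlim)

theorem HasAsympProb.of_condIndicator {c : Word E → Three} {A D : ℕ → Set (ℕ → Atom E)}
    {A' D' : Set (ℕ → Atom E)} {f : ℕ → (ℕ → Atom E) → ℕ → Atom E}
    (hf : ∀ n, MeasurePreserving (f n) (prodProb μ) (prodProb μ))
    (hc : ∀ n w, process c n w = condIndicator (A n) (D n) (f n w))
    (hA : ∀ n, MeasurableSet (A n)) (hD : ∀ n, MeasurableSet (D n))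
    (hA' : ∀ w, ∀ᶠ n in atTop, w ∈ A n ↔ w ∈ A') (hD' : ∀ w, ∀ᶠ n in atTop, w ∈ D n ↔ w ∈ D')
    (hindep : (prodProb μ).real (A' ∩ D') = (prodProb μ).real A' * (prodProb μ).real D')
    (hne : (prodProb μ).real D' ≠ 0) : HasAsympProb μ c ((prodProb μ).real A') := by
  have hdef (n : ℕ) : (prodProb μ).real {w | process c n w ≠ Three.undef} =
      (prodProb μ).real (D n) := by
    rw [← (hf n).measureReal_preimage (hD n).nullMeasurableSet]
    simp only [hc, ne_eq, condIndicator_eq_undef_iff, not_not]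
    rfl
  have hone (n : ℕ) : (prodProb μ).real {w | process c n w = Three.one} =
      (prodProb μ).real (A n ∩ D n) := by
    rw [← (hf n).measureReal_preimage ((hA n).inter (hD n)).nullMeasurableSet]
    simp only [hc, condIndicator_eq_one_iff]
    rfl
  have hlimD := tendsto_measureReal_of_tendsto_indicator (P := prodProb μ) hD hD'
  have hlimAD := tendsto_measureReal_of_tendsto_indicator (P := prodProb μ) (B := A' ∩ D')
    (fun n => (hA n).inter (hD n)) fun w => by
      filter_upwards [hA' w, hD' w] with n hnA hnD using and_congr hnA hnD
  simp only [HasAsympProb, hdef, hone]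
  refine ⟨hlimD.eventually_ne hne, ?_⟩
  have hlim := hlimAD.div hlimD hne
  rwa [hindep, mul_div_cancel_right₀ _ hne] at hlim

theorem HasAsympProb.asympProb_eq {c : Word E → Three} {r : ℝ} (h : HasAsympProb μ c r) :
    asympProb μ c = some r := by
  have hex : ∃ r, HasAsympProb μ c r := ⟨r, h⟩
  rw [asympProb, dif_pos hex]
  exact congrArg some (tendsto_nhds_unique hex.choose_spec.2 h.2)

variable (μ)

theorem FlatExpr.hasAsympProb_first (e : FlatExpr E) : HasAsympProb μ e.first (e.psProb μ) :=
  .of_condIndicator (fun _ => .id _) e.process_first e.measurableSet_psUpTo (fun _ => .univ)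
    e.eventually_mem_psUpTo_iff (fun _ => .of_forall fun _ => Iff.rfl) (by simp) (by simp)

theorem FlatExpr.hasAsympProb_sparse (e : FlatExpr E) : HasAsympProb μ e.sparse (e.psProb μ) := by
  have hcount : e.conditions.Countable := Set.to_countable _
  refine .of_condIndicator (measurePreserving_reversePrefix μ) e.process_sparse
    e.measurableSet_psUpTo
    (fun n => .biUnion hcount fun b _ => measurableSet_headOrNeverUpTo (measurableSet_event b) n)
    e.eventually_mem_psUpTo_iff e.eventually_mem_biUnion_headOrNeverUpTo_iff
    (infinitePi_inter_biUnion_headOrNever μ e.measurableSet_ps hcount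
      (fun b _ => measurableSet_event b) fun _ => e.mem_ps_iff_tail) ?_
  obtain ⟨b, hb⟩ := e.conditions_nonempty
  refine ENNReal.toReal_ne_zero.2 ⟨fun h0 => ?_, measure_ne_top _ _⟩
  exact infinitePi_headOrNever_ne_zero μ (measurableSet_event b)
    (measure_mono_null (Set.subset_biUnion_of_mem hb) h0)

theorem asympProb_first_eq_asympProb_sparse (e : FlatExpr E) :
    asympProb μ e.first = asympProb μ e.sparse :=
  (e.hasAsympProb_first μ).asympProb_eq.trans (e.hasAsympProb_sparse μ).asympProb_eq.symm

end Asymptotic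

/-! ### The conditional `(∅|a)` -/

section Impossible

variable [Fintype E] (μ : Measure (Atom E)) [IsProbabilityMeasure μ]

theorem Indep.of_deterministic {c d : Word E → Three} {x₀ y₀ : ℕ → Three}
    (hc : ∀ n w, process c n w = x₀ n) (hd : ∀ n w, process d n w = y₀ n) : Indep μ c d := by
  intro t x y
  simp only [hc, hd]
  by_cases hx : ∀ i : Fin t, x₀ i = x i <;> by_cases hy : ∀ i : Fin t, y₀ i = y i <;>
    simp [hx, hy]

variable {μ} in
theorem Indep.prodProb_history_eq_zero_or_one {c : Word E → Three} (h : Indep μ c c) {t : ℕ}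
    (x : Fin t → Three) :
    prodProb μ {w | ∀ i : Fin t, process c i w = x i} = 0 ∨
      prodProb μ {w | ∀ i : Fin t, process c i w = x i} = 1 := by
  have hsq := h t x x
  simp only [and_self] at hsq
  refine or_iff_not_imp_left.2 fun h0 => ?_
  exact (ENNReal.mul_eq_left h0 (measure_ne_top _ _)).1 hsq.symm

theorem process_first_simple_empty (a : Event E) (n : ℕ) (w : ℕ → Atom E) :
    process (FlatExpr.simple ∅ a).first n w = Three.zero := by
  simp [FlatExpr.process_first, condIndicator, FlatExpr.psUpTo, hitCylinder, Set.mem_accumulate]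

theorem indep_first_simple_empty (a : Event E) :
    Indep μ (FlatExpr.simple ∅ a).first (FlatExpr.simple ∅ a).first :=
  .of_deterministic μ (process_first_simple_empty a) (process_first_simple_empty a)

theorem process_sparse_simple_empty_history_iff (a : Event E) (w : ℕ → Atom E) :
    (∀ i : Fin 2, process (FlatExpr.simple ∅ a).sparse i w = ![Three.zero, Three.undef] i) ↔
      w 0 ∈ a ∧ w 1 ∈ aᶜ := by
  by_cases hw0 : w 0 ∈ a <;> by_cases hw1 : w 1 ∈ a <;>
    simp [FlatExpr.process_sparse, condIndicator, FlatExpr.psUpTo, FlatExpr.conditions,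
      hitCylinder, Set.mem_accumulate, reversePrefix_mem_headOrNeverUpTo_iff, hw0, hw1,
      Nat.le_one_iff_eq_zero_or_eq_one]

theorem not_indep_sparse_simple_empty {a : Event E} (h0 : 0 < μ a) (h1 : μ a < 1) :
    ¬ Indep μ (FlatExpr.simple ∅ a).sparse (FlatExpr.simple ∅ a).sparse := by
  intro h
  have ha := measurableSet_event a
  have hhistory := h.prodProb_history_eq_zero_or_one ![Three.zero, Three.undef]
  simp only [process_sparse_simple_empty_history_iff, prodProb,
    infinitePi_letters_mem μ zero_ne_one ha ha.compl] at hhistory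
  have hpos : μ a * μ aᶜ ≠ 0 := mul_ne_zero h0.ne' ((prob_compl_eq_zero_iff ha).not.2 h1.ne)
  have hlt : μ a * μ aᶜ < 1 := (mul_le_of_le_one_right' prob_le_one).trans_lt h1
  exact hhistory.elim hpos hlt.ne

theorem not_exists_equalities_simple_empty {a : Event E} (h0 : 0 < μ a) (h1 : μ a < 1) :
    ¬ ∃ S : Set (ProbTerm E × ProbTerm E),
      (Indep μ (FlatExpr.simple ∅ a).first (FlatExpr.simple ∅ a).first ↔
        EqualitiesHold (fun e => asympProb μ e.first) S) ∧
      (Indep μ (FlatExpr.simple ∅ a).sparse (FlatExpr.simple ∅ a).sparse ↔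
        EqualitiesHold (fun e => asympProb μ e.sparse) S) := by
  rintro ⟨S, hfirst, hsparse⟩
  simp only [← asympProb_first_eq_asympProb_sparse] at hsparse
  exact not_indep_sparse_simple_empty μ h0 h1 (hsparse.2 (hfirst.1 (indep_first_simple_empty μ a)))

end Impossible

theorem exists_isProbabilityMeasure_mem_Ioo (α : Type*) [MeasurableSpace α]
    [MeasurableSingletonClass α] [Nontrivial α] :
    ∃ (μ : Measure α) (_ : IsProbabilityMeasure μ) (a : Set α), 0 < μ a ∧ μ a < 1 := by
  classical
  obtain ⟨x, y, hxy⟩ := exists_pair_ne α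
  let p := PMF.uniformOfFinset {x, y} (Finset.insert_nonempty x {y})
  have hp : p.toMeasure {x} = 2⁻¹ := by
    rw [PMF.toMeasure_apply_singleton _ _ (measurableSet_singleton x),
      PMF.uniformOfFinset_apply_of_mem _ (Finset.mem_insert_self x {y}), Finset.card_pair hxy]
    rfl
  refine ⟨p.toMeasure, inferInstance, {x}, ?_⟩
  rw [hp]
  exact ⟨by simp, ENNReal.inv_lt_one.2 ENNReal.one_lt_two⟩

end CondEvent


theorem mainTheorem4 {E : Type*} [Fintype E] [Nonempty E] :
    -- both interpretations preserve all probabilities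
    (∀ (μ : Measure (Atom E)) [IsProbabilityMeasure μ] (e : FlatExpr E),
      HasAsympProb μ e.first (e.psProb μ) ∧ HasAsympProb μ e.sparse (e.psProb μ)) ∧
    -- the conditional `(0|a)` paired with itself, for every event `a` with `0 < Pr(a) < 1`
    (∀ (μ : Measure (Atom E)) [IsProbabilityMeasure μ] (a : Event E), 0 < μ a → μ a < 1 →
      (∀ (n : ℕ) (w : ℕ → Atom E),
        process (FlatExpr.simple ∅ a).first n w = Three.zero) ∧
      Indep μ (FlatExpr.simple ∅ a).first (FlatExpr.simple ∅ a).first ∧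
      ¬ Indep μ (FlatExpr.simple ∅ a).sparse (FlatExpr.simple ∅ a).sparse ∧
      ¬ ∃ S : Set (ProbTerm E × ProbTerm E),
        (Indep μ (FlatExpr.simple ∅ a).first (FlatExpr.simple ∅ a).first ↔
          EqualitiesHold (fun e => asympProb μ e.first) S) ∧
        (Indep μ (FlatExpr.simple ∅ a).sparse (FlatExpr.simple ∅ a).sparse ↔
          EqualitiesHold (fun e => asympProb μ e.sparse) S)) ∧
    -- such a probability space and such expressions exist
    (∃ (μ : Measure (Atom E)) (_ : IsProbabilityMeasure μ) (e₁ e₂ : FlatExpr E),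
      Indep μ e₁.first e₂.first ∧ ¬ Indep μ e₁.sparse e₂.sparse) ∧
    -- no equalities of asymptotic probabilities characterize independence
    ¬ ∃ S : FlatExpr E → FlatExpr E → Set (ProbTerm E × ProbTerm E),
      CharacterizesIndep FlatExpr.first S ∧ CharacterizesIndep FlatExpr.sparse S := by
  refine ⟨fun μ _ e => ⟨e.hasAsympProb_first μ, e.hasAsympProb_sparse μ⟩,
    fun μ _ a h0 h1 => ⟨process_first_simple_empty a, indep_first_simple_empty μ a,
      not_indep_sparse_simple_empty μ h0 h1, not_exists_equalities_simple_empty μ h0 h1⟩, ?_, ?_⟩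
  all_goals obtain ⟨μ, _, a, h0, h1⟩ := exists_isProbabilityMeasure_mem_Ioo (Atom E)
  · exact ⟨μ, ‹_›, .simple ∅ a, .simple ∅ a, indep_first_simple_empty μ a,
      not_indep_sparse_simple_empty μ h0 h1⟩
  · rintro ⟨S, hfirst, hsparse⟩
    exact not_exists_equalities_simple_empty μ h0 h1 ⟨S _ _, hfirst μ _ _, hsparse μ _ _⟩
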